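/- **Theorem (Cotangent Formula).** Let $\mathcal X$ be a Euclidean simplicial complex, i.e. an abstract simplicial complex together with a length $\ell_e>0$ for every $1$-simplex $e$ such that, for every simplex $\sigma\in\mathcal X$, the unique constant symmetric bilinear form $g_\sigma$ on the affine simplex $\sigma$ with $g_\sigma(b-a,b-a)=\ell_{\{a,b\}}^2$ for all vertices $a\neq b$ of $\sigma$ is positive definite. Thus each simplex is a Euclidean simplex, with its induced scalar product on (co)vectors and its induced volume of the appropriate dimension (a point has volume $1$). For a vertex $i$ let $x_i$ denote the barycentric coordinate of $i$, i.e. the function on $\mathcal X$ that is affine on each simplex, with $x_i(i)=1$ and $x_i(k)=0$ for every vertex $k\ne i$. Let $\sigma\in\mathcal X$ be a simplex of dimension $n>1$. Then for vertices $i\neq j$ of $\mathcal X$ $$ c_\sigma^{ij}:=\int_\sigma\langle dx_i,dx_j\rangle=\begin{cases}-\dfrac{1}{n(n-1)}\,\cot\alpha_\sigma^{ij}\;\mathrm{vol}\bigl(\sigma\setminus\{i,j\}\bigr), & \text{if }\{i,j\}\subset\sigma,\\[2mm] 0 & \text{otherwise,}\end{cases} $$ where $\alpha_\sigma^{ij}\in(0,\pi)$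 denotes the (interior) dihedral angle of $\sigma$ between the faces $\sigma\setminus\{i\}$ and $\sigma\setminus\{j\}$, which meet along $\sigma\setminus\{i,j\}$. Moreover, for every vertex $i$ of $\mathcal X$, $$ c_\sigma^{ii}:=\int_\sigma|dx_i|^2=\begin{cases}\dfrac{1}{n\,h_i}\;\mathrm{vol}\bigl(\sigma\setminus\{i\}\bigr), & \text{if }i\in\sigma,\\[2mm] 0 & \text{otherwise,}\end{cases} $$ where $h_i$ denotes the height of $i$ in $\sigma$, i.e. the distance between the vertex $i$ and the hyperplane (affine hull) spanned by the opposite face $\sigma\setminus\{i\}$. -/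

import Mathlib

open MeasureTheory

noncomputable section

/-- Squared length of the segment between two vertices, from a length function on edges. -/
def sqLength {V : Type*} [DecidableEq V] (ℓ : Finset V → ℝ) (a b : V) : ℝ :=
  if a = b then 0 else ℓ {a, b} ^ 2

/-- The symmetric bilinear form on vectors with coordinate sum zero which is determined by its
values `f a b` on the edge vectors `b - a` (see `edgeForm_edge`), written symmetrically in all
vertices. -/
def edgeForm {τ : Type*} [Fintype τ] (f : τ → τ → ℝ) (X Y : τ → ℝ) : ℝ :=
  -(1 / 2) * ∑ a, ∑ b, f a b * X a * Y b

theorem edgeForm_edge {τ : Type*} [Fintype τ] [DecidableEq τ] (f : τ → τ → ℝ)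
    (hsymm : ∀ a b, f a b = f b a) (hdiag : ∀ a, f a a = 0) (a b : τ) :
    edgeForm f (Pi.single b 1 - Pi.single a 1) (Pi.single b 1 - Pi.single a 1) = f a b := by
  simp [edgeForm, mul_sub, Finset.sum_sub_distrib, Pi.single_apply, hdiag, hsymm b a]
  ring

/-- An (abstract) simplicial complex with a discrete metric: a positive length for each
1-simplex, such that on each simplex the constant symmetric tensor whose value on every edge
vector is the squared edge length is positive definite. Only the values of `length` on 1-simplices
are used. -/
structure EuclideanSimplicialComplex (V : Type*) [DecidableEq V] extends
    PreAbstractSimplicialComplex V where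
  length : Finset V → ℝ
  length_pos : ∀ e ∈ faces, e.card = 2 → 0 < length e
  posDef : ∀ σ ∈ faces, ∀ X : σ → ℝ, ∑ a, X a = 0 → X ≠ 0 →
    0 < edgeForm (fun a b : σ => sqLength length (a : V) (b : V)) X X

/-- The vectors with coordinate sum zero. -/
def sumZero (τ : Type*) [Fintype τ] : Submodule ℝ (τ → ℝ) where
  carrier := {X | ∑ a, X a = 0}
  add_mem' := by
    intro X Y hX hY
    simp only [Set.mem_ofPred_eq] at hX hY ⊢
    simp [Finset.sum_add_distrib, hX, hY]
  zero_mem' := by simp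
  smul_mem' := by
    intro c X hX
    simp only [Set.mem_ofPred_eq] at hX ⊢
    simp [← Finset.mul_sum, hX]

namespace EuclideanSimplicialComplex

variable {V : Type*} [DecidableEq V] {K : EuclideanSimplicialComplex V}

/-- A simplex of the complex. -/
structure Simplex (K : EuclideanSimplicialComplex V) where
  verts : Finset V
  mem_faces : verts ∈ K.faces

namespace Simplex

theorem verts_nonempty (σ : K.Simplex) : σ.verts.Nonempty :=
  (K.isRelLowerSet_faces σ.mem_faces).1

/-- The dimension of a simplex: one less than the number of its vertices. -/
def dim (σ : K.Simplex) : ℕ := σ.verts.card - 1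

/-- The face `σ ∖ S`, where `S` has fewer elements than `σ`. -/
def without (σ : K.Simplex) (S : Finset V) (hS : S.card ≤ σ.dim) : K.Simplex where
  verts := σ.verts \ S
  mem_faces := by
    refine (K.isRelLowerSet_faces σ.mem_faces).2 Finset.sdiff_subset ?_
    have h1 := σ.verts_nonempty.card_pos
    have h2 := Finset.le_card_sdiff S σ.verts
    unfold dim at hS
    exact Finset.card_pos.1 (by omega)

/-- The scalar product on `σ` given by the discrete metric, on the vectors of the affine space
spanned by the realization of `σ` (in barycentric coordinates). -/
def metric (σ : K.Simplex) (X Y : sumZero σ.verts) : ℝ :=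
  edgeForm (fun a b : σ.verts => sqLength K.length (a : V) (b : V)) X Y

theorem metric_pos (σ : K.Simplex) (X : sumZero σ.verts) (hX : X ≠ 0) : 0 < σ.metric X X :=
  K.posDef σ.verts σ.mem_faces X X.2 fun h => hX (Subtype.ext h)

/-- The metric of `σ` is a scalar product. -/
@[reducible]
def innerCore (σ : K.Simplex) : InnerProductSpace.Core ℝ (sumZero σ.verts) where
  inner X Y := σ.metric X Y
  conj_inner_symm X Y := by
    simp only [metric, edgeForm, conj_trivial]
    rw [Finset.sum_comm]
    congr 1
    refine Finset.sum_congr rfl fun a _ => Finset.sum_congr rfl fun b _ => ?_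
    have h : sqLength K.length (b : V) (a : V) = sqLength K.length (a : V) (b : V) := by
      simp only [sqLength, Finset.pair_comm, eq_comm]
    rw [h]
    ring
  re_inner_nonneg X := by
    by_cases h : X = 0
    · subst h
      simp [metric, edgeForm]
    · exact (σ.metric_pos X h).le
  add_left X Y Z := by
    simp only [metric, edgeForm, Submodule.coe_add, Pi.add_apply, mul_add, add_mul,
      Finset.sum_add_distrib]
  smul_left X Y r := by
    simp only [metric, edgeForm, Submodule.coe_smul, Pi.smul_apply, smul_eq_mul, conj_trivial,
      Finset.mul_sum]
    refine Finset.sum_congr rfl fun a _ => Finset.sum_congr rfl fun b _ => ?_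
    ring
  definite X h := by
    by_contra hX
    exact (σ.metric_pos X hX).ne' h

/-- The vector space of the affine space spanned by the realization of `σ`, as a Euclidean vector
space with the scalar product `metric`. -/
def Tangent (σ : K.Simplex) : Type _ := ↥(sumZero σ.verts)

instance (σ : K.Simplex) : NormedAddCommGroup σ.Tangent :=
  @InnerProductSpace.Core.toNormedAddCommGroup ℝ (sumZero σ.verts) _ _ _ σ.innerCore

instance (σ : K.Simplex) : InnerProductSpace ℝ σ.Tangent :=
  @InnerProductSpace.ofCore ℝ (sumZero σ.verts) _ _ _ σ.innerCore.toCore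

instance (σ : K.Simplex) : FiniteDimensional ℝ σ.Tangent :=
  inferInstanceAs (FiniteDimensional ℝ (sumZero σ.verts))

instance (σ : K.Simplex) : CompleteSpace σ.Tangent := FiniteDimensional.complete ℝ σ.Tangent

instance (σ : K.Simplex) : MeasurableSpace σ.Tangent := borel σ.Tangent

instance (σ : K.Simplex) : BorelSpace σ.Tangent := ⟨rfl⟩

theorem Tangent.inner_eq {σ : K.Simplex} (X Y : σ.Tangent) : inner ℝ X Y = σ.metric X Y := rfl

/-- The barycentric components of a tangent vector. -/
def Tangent.comp {σ : K.Simplex} (X : σ.Tangent) : σ.verts → ℝ := Subtype.val X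

theorem Tangent.sum_comp {σ : K.Simplex} (X : σ.Tangent) : ∑ a, X.comp a = 0 := X.2

/-- The affine space spanned by the realization of `σ`: affine combinations of its vertices, given
by their barycentric coordinates. -/
@[ext]
structure Hull (σ : K.Simplex) where
  coord : σ.verts → ℝ
  sum_coord : ∑ a, coord a = 1

/-- The realization of a vertex. -/
def vertex (σ : K.Simplex) (a : σ.verts) : σ.Hull where
  coord := Pi.single a 1
  sum_coord := by simp

instance (σ : K.Simplex) : Nonempty σ.Hull :=
  ⟨σ.vertex ⟨σ.verts_nonempty.choose, σ.verts_nonempty.choose_spec⟩⟩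

instance (σ : K.Simplex) : AddTorsor σ.Tangent σ.Hull where
  vadd X p := ⟨X.comp + p.coord, by
    simp only [Pi.add_apply, Finset.sum_add_distrib, p.sum_coord, X.sum_comp, zero_add]⟩
  vsub p q := ⟨p.coord - q.coord, by
    change ∑ a, (p.coord - q.coord) a = 0
    simp only [Pi.sub_apply, Finset.sum_sub_distrib, p.sum_coord, q.sum_coord, sub_self]⟩
  zero_vadd p := Hull.ext (zero_add p.coord)
  add_vadd X Y p := Hull.ext (add_assoc X.comp Y.comp p.coord)
  vsub_vadd' p q := Hull.ext (sub_add_cancel p.coord q.coord)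
  vadd_vsub' X p := Subtype.ext (add_sub_cancel_right X.comp p.coord)

instance (σ : K.Simplex) : MetricSpace σ.Hull :=
  metricSpaceOfNormedAddCommGroupOfAddTorsor σ.Tangent σ.Hull

instance (σ : K.Simplex) : NormedAddTorsor σ.Tangent σ.Hull where
  dist_eq_norm' _ _ := rfl

instance (σ : K.Simplex) : MeasurableSpace σ.Hull := borel σ.Hull

instance (σ : K.Simplex) : BorelSpace σ.Hull := ⟨rfl⟩

/-- The edges of `σ` have the prescribed lengths. -/
theorem dist_vertex (σ : K.Simplex) (a b : σ.verts) (hab : a ≠ b) :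
    dist (σ.vertex a) (σ.vertex b) = K.length {(a : V), (b : V)} := by
  have hab' : (a : V) ≠ b := fun h => hab (Subtype.ext h)
  have he : ({(a : V), (b : V)} : Finset V) ∈ K.faces :=
    (K.isRelLowerSet_faces σ.mem_faces).2
      (by intro x hx; simp only [Finset.mem_insert, Finset.mem_singleton] at hx
          rcases hx with rfl | rfl; exacts [a.2, b.2]) (by simp)
  have hpos := K.length_pos _ he (Finset.card_pair hab')
  have h : dist (σ.vertex a) (σ.vertex b) ^ 2 = K.length {(a : V), (b : V)} ^ 2 := by
    rw [dist_eq_norm_vsub σ.Tangent, ← real_inner_self_eq_norm_sq, Tangent.inner_eq]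
    change edgeForm (fun a b : σ.verts => sqLength K.length (a : V) (b : V))
      (Pi.single a 1 - Pi.single b 1) (Pi.single a 1 - Pi.single b 1) = _
    rw [edgeForm_edge]
    · simp [sqLength, hab'.symm, Finset.pair_comm]
    · intro a b
      simp only [sqLength, Finset.pair_comm, eq_comm]
    · simp [sqLength]
  exact (sq_eq_sq₀ dist_nonneg hpos.le).1 h

/-- The realization of `σ` inside the affine space it spans. -/
def carrier (σ : K.Simplex) : Set σ.Hull := {p | ∀ a, 0 ≤ p.coord a}

/-- The Euclidean volume measure on the realization of `σ`. -/
def volumeMeasure (σ : K.Simplex) : Measure σ.Hull :=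
  (Measure.euclideanHausdorffMeasure σ.dim).restrict σ.carrier

/-- The volume of `σ`, of the dimension of `σ` (a vertex has volume one). -/
def vol (σ : K.Simplex) : ℝ := σ.volumeMeasure.real Set.univ

/-- The restriction to `σ` of the barycentric coordinate function `x_i` of a vertex `i` of the
complex. It vanishes if `i` is not a vertex of `σ`. -/
def bary (σ : K.Simplex) (i : V) (p : σ.Hull) : ℝ :=
  if h : i ∈ σ.verts then p.coord ⟨i, h⟩ else 0

theorem bary_vertex (σ : K.Simplex) (i : V) (a : σ.verts) :
    σ.bary i (σ.vertex a) = if (a : V) = i then 1 else 0 := by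
  unfold bary vertex
  split_ifs with h1 h2 h2
  · subst h2; simp
  · exact Pi.single_eq_of_ne (fun h => h2 (congrArg Subtype.val h).symm) _
  · exact (h1 (h2 ▸ a.2)).elim
  · rfl

/-- The differential of a function on the affine space spanned by `σ`. -/
def differential (σ : K.Simplex) (f : σ.Hull → ℝ) (p : σ.Hull) : StrongDual ℝ σ.Tangent :=
  fderiv ℝ (fun X : σ.Tangent => f (X +ᵥ p)) 0

/-- The scalar product of covectors induced by the scalar product on `σ`. The corresponding norm
is the operator norm. -/
def cotangentInner (σ : K.Simplex) (φ ψ : StrongDual ℝ σ.Tangent) : ℝ :=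
  inner ℝ ((InnerProductSpace.toDual ℝ σ.Tangent).symm φ)
    ((InnerProductSpace.toDual ℝ σ.Tangent).symm ψ)

/-- The height of a vertex over the opposite face: its distance to the hyperplane spanned by that
face. -/
def height (σ : K.Simplex) (a : σ.verts) : ℝ :=
  Metric.infDist (σ.vertex a) (affineSpan ℝ (σ.vertex '' {a}ᶜ) : Set σ.Hull)

/-- The direction of the affine space spanned by the common face `σ ∖ {a, b}` of the faces
`σ ∖ {a}` and `σ ∖ {b}`. -/
def hingeDirection (σ : K.Simplex) (a b : σ.verts) : Submodule ℝ σ.Tangent :=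
  (affineSpan ℝ (σ.vertex '' {a, b}ᶜ)).direction

/-- The barycentre of the common face `σ ∖ {a, b}`. -/
def hingeCenter (σ : K.Simplex) (a b : σ.verts) : σ.Hull :=
  Finset.centroid ℝ ({a, b}ᶜ : Finset σ.verts) σ.vertex

/-- The dihedral angle between the faces `σ ∖ {a}` and `σ ∖ {b}`: the angle between the directions
orthogonal to their common face `σ ∖ {a, b}` which point from it into `σ ∖ {a}`
(i.e. towards `b`) and into `σ ∖ {b}` (i.e. towards `a`). -/
def dihedralAngle (σ : K.Simplex) (a b : σ.verts) : ℝ :=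
  InnerProductGeometry.angle
    ((σ.hingeDirection a b)ᗮ.starProjection (σ.vertex b -ᵥ σ.hingeCenter a b))
    ((σ.hingeDirection a b)ᗮ.starProjection (σ.vertex a -ᵥ σ.hingeCenter a b))

end Simplex

end EuclideanSimplicialComplex

end

noncomputable section

namespace EuclideanSimplicialComplex

variable {V : Type*} [DecidableEq V] {K : EuclideanSimplicialComplex V}

namespace Simplex

/-! Barycentric coordinates are affine on `σ`, so their differentials are constant. Writing `g_i`
for the gradient of `x_i`, the integrals are `vol σ * ⟨g_i, g_j⟩` and `vol σ * |g_i|²`, and only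
volumes and angles have to be expressed through gradients.

Along the perpendicular from `i` to the opposite facet, `x_i` drops from 1 to 0 at rate `|g_i|`, so
`h_i = 1 / |g_i|` (`height_eq_inv_norm_grad`). Slicing `σ` by the levels of `x_i` gives the cone
formula `vol σ = vol (σ ∖ i) / (n |g_i|)` (`IsOpposite.vol_eq`). Together these give the diagonal
case.

For `i ≠ j` the cone formula is applied twice, to `σ` and to its facet `ρ = σ ∖ i`. The gradient of
`x_j` on `ρ` is the projection of `g_j` orthogonal to `g_i`, so the product of the two gradient
norms is the square root of the Gram determinant `D` of `g_i, g_j` (`IsOpposite.norm_grad_sq_mul`).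
In the plane orthogonal to the hinge, the two directions spanning the dihedral angle form the basis
dual to `g_i, g_j`; hence `cot α = -⟨g_i, g_j⟩ / √D` (`cot_dihedralAngle`), and `√D` cancels. -/

/-! ### Barycentric coordinates as affine functions; spans of vertices. -/

theorem Tangent.ext {σ : K.Simplex} {X Y : σ.Tangent} (h : X.comp = Y.comp) : X = Y :=
  Subtype.ext h

@[simp]
theorem Tangent.comp_sub {σ : K.Simplex} (X Y : σ.Tangent) : (X - Y).comp = X.comp - Y.comp := rfl

@[simp]
theorem Tangent.comp_smul {σ : K.Simplex} (c : ℝ) (X : σ.Tangent) : (c • X).comp = c • X.comp := rfl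

@[simp]
theorem comp_vsub {σ : K.Simplex} (p q : σ.Hull) : (p -ᵥ q).comp = p.coord - q.coord := rfl

@[simp]
theorem coord_vadd {σ : K.Simplex} (X : σ.Tangent) (p : σ.Hull) :
    (X +ᵥ p).coord = X.comp + p.coord := rfl

theorem coord_vertex_self (σ : K.Simplex) (a : σ.verts) : (σ.vertex a).coord a = 1 :=
  Pi.single_eq_same _ _

theorem coord_vertex_of_ne (σ : K.Simplex) {a b : σ.verts} (h : b ≠ a) :
    (σ.vertex a).coord b = 0 :=
  Pi.single_eq_of_ne h _

/-- The differential of a barycentric coordinate. -/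
def coordCLM (σ : K.Simplex) (a : σ.verts) : StrongDual ℝ σ.Tangent :=
  LinearMap.toContinuousLinearMap
    { toFun := fun X => X.comp a
      map_add' := fun _ _ => rfl
      map_smul' := fun _ _ => rfl }

@[simp]
theorem coordCLM_apply (σ : K.Simplex) (a : σ.verts) (X : σ.Tangent) :
    σ.coordCLM a X = X.comp a := rfl

/-- A barycentric coordinate as an affine map. -/
def coordAffine (σ : K.Simplex) (a : σ.verts) : σ.Hull →ᵃ[ℝ] ℝ where
  toFun p := p.coord a
  linear := (σ.coordCLM a).toLinearMap
  map_vadd' _ _ := rfl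

@[simp]
theorem coordAffine_apply (σ : K.Simplex) (a : σ.verts) (p : σ.Hull) :
    σ.coordAffine a p = p.coord a := rfl

theorem continuous_coord (σ : K.Simplex) (a : σ.verts) :
    Continuous fun p : σ.Hull => p.coord a := by
  have h : (fun p : σ.Hull => p.coord a) =
      fun p => σ.coordCLM a (p -ᵥ σ.vertex a) + (σ.vertex a).coord a := by
    ext p
    simp
  rw [h]
  fun_prop

theorem isClosed_carrier (σ : K.Simplex) : IsClosed σ.carrier := by
  simp only [carrier, Set.ofPred_forall]
  exact isClosed_iInter fun a => isClosed_le continuous_const (σ.continuous_coord a)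

theorem coord_affineCombination (σ : K.Simplex) (s : Finset σ.verts) (w : σ.verts → ℝ)
    (hw : ∑ a ∈ s, w a = 1) (b : σ.verts) :
    (s.affineCombination ℝ σ.vertex w).coord b = if b ∈ s then w b else 0 := by
  rw [← coordAffine_apply, s.map_affineCombination σ.vertex w hw,
    Finset.affineCombination_eq_linear_combination _ _ _ hw]
  simp [vertex, Pi.single_apply]

theorem mem_affineSpan_vertex_iff (σ : K.Simplex) (S : Set σ.verts) (q : σ.Hull) :
    q ∈ affineSpan ℝ (σ.vertex '' S) ↔ ∀ a ∉ S, q.coord a = 0 := by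
  classical
  constructor
  · intro hq a ha
    refine affineSpan_induction (p := fun q : σ.Hull => q.coord a = 0) hq ?_ ?_
    · rintro _ ⟨b, hb, rfl⟩
      exact σ.coord_vertex_of_ne fun h => ha (h ▸ hb)
    · intro c u v w hu hv hw
      simp [hu, hv, hw]
  · intro h
    -- Every point is the combination of the vertices weighted by its own coordinates.
    have hq : q = Finset.univ.affineCombination ℝ σ.vertex q.coord := by
      ext b
      rw [coord_affineCombination _ _ _ q.sum_coord]
      simp
    rw [hq]
    exact affineCombination_mem_affineSpan_image q.sum_coord (fun a _ ha => h a ha) _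

theorem mem_direction_affineSpan_vertex_iff (σ : K.Simplex) {S : Set σ.verts} (hS : S.Nonempty)
    (X : σ.Tangent) :
    X ∈ (affineSpan ℝ (σ.vertex '' S)).direction ↔ ∀ a ∉ S, X.comp a = 0 := by
  obtain ⟨b, hb⟩ := hS
  rw [← AffineSubspace.vadd_mem_iff_mem_direction X
    (subset_affineSpan ℝ _ (Set.mem_image_of_mem σ.vertex hb)), mem_affineSpan_vertex_iff]
  refine forall₂_congr fun a ha => ?_
  simp [σ.coord_vertex_of_ne (fun h : a = b => ha (h ▸ hb))]

/-- The tangent space is the kernel of the nonzero functional "sum of components". This matches the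
dimension of the Hausdorff measure in `volumeMeasure` with that of the ambient space. -/
theorem finrank_tangent (σ : K.Simplex) : Module.finrank ℝ σ.Tangent = σ.dim := by
  let f : Module.Dual ℝ (σ.verts → ℝ) := ∑ a, LinearMap.proj a
  have hf : f ≠ 0 := by
    intro h
    obtain ⟨a, ha⟩ := σ.verts_nonempty
    have := congrArg (fun g => g (Pi.single ⟨a, ha⟩ 1)) h
    simp [f] at this
  have hk : LinearMap.ker f = sumZero σ.verts := by
    ext X
    simp [f, sumZero]
  have h := Module.Dual.finrank_ker_add_one_of_ne_zero hf
  rw [hk] at h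
  simp only [Module.finrank_fintype_fun_eq_card, Fintype.card_coe] at h
  change Module.finrank ℝ (sumZero σ.verts) = _
  unfold dim
  omega

/-! ### Gradients and heights. -/

/-- The gradient of a barycentric coordinate. -/
def grad (σ : K.Simplex) (a : σ.verts) : σ.Tangent :=
  (InnerProductSpace.toDual ℝ σ.Tangent).symm (σ.coordCLM a)

theorem inner_grad (σ : K.Simplex) (a : σ.verts) (X : σ.Tangent) :
    inner ℝ (σ.grad a) X = X.comp a := by
  simp [grad, InnerProductSpace.toDual_symm_apply]

theorem differential_bary (σ : K.Simplex) (a : σ.verts) (p : σ.Hull) :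
    σ.differential (σ.bary a) p = σ.coordCLM a := by
  have h : (fun X : σ.Tangent => σ.bary a (X +ᵥ p)) = fun X => σ.coordCLM a X + p.coord a := by
    ext X
    simp [bary]
  rw [differential, h, fderiv_add_const, ContinuousLinearMap.fderiv]

theorem differential_bary_of_notMem (σ : K.Simplex) {i : V} (hi : i ∉ σ.verts) (p : σ.Hull) :
    σ.differential (σ.bary i) p = 0 := by
  have h : (fun X : σ.Tangent => σ.bary i (X +ᵥ p)) = fun _ => (0 : ℝ) := by
    ext X
    simp [bary, hi]
  rw [differential, h, fderiv_fun_const]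
  rfl

theorem cotangentInner_coordCLM (σ : K.Simplex) (a b : σ.verts) :
    σ.cotangentInner (σ.coordCLM a) (σ.coordCLM b) = inner ℝ (σ.grad a) (σ.grad b) := rfl

theorem norm_coordCLM (σ : K.Simplex) (a : σ.verts) : ‖σ.coordCLM a‖ = ‖σ.grad a‖ := by
  simp [grad]

theorem exists_ne_of_dim_pos (σ : K.Simplex) (hσ : 0 < σ.dim) (a : σ.verts) :
    ∃ b : σ.verts, b ≠ a := by
  have h : 1 < σ.verts.card := by unfold dim at hσ; omega
  obtain ⟨b, hb, hne⟩ := σ.verts.exists_mem_ne h a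
  exact ⟨⟨b, hb⟩, fun h => hne (congrArg Subtype.val h)⟩

theorem exists_ne_ne_of_one_lt_dim (σ : K.Simplex) (hσ : 1 < σ.dim) (a b : σ.verts) :
    ∃ c : σ.verts, c ≠ a ∧ c ≠ b := by
  have h : ({(a : V), (b : V)} : Finset V).card < σ.verts.card := by
    have := Finset.card_le_two (a := (a : V)) (b := (b : V))
    unfold dim at hσ
    omega
  obtain ⟨c, hc, hc'⟩ := Finset.exists_mem_notMem_of_card_lt_card h
  simp only [Finset.mem_insert, Finset.mem_singleton, not_or] at hc'
  exact ⟨⟨c, hc⟩, fun h => hc'.1 (congrArg Subtype.val h), fun h => hc'.2 (congrArg Subtype.val h)⟩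

theorem grad_ne_zero (σ : K.Simplex) (hσ : 0 < σ.dim) (a : σ.verts) : σ.grad a ≠ 0 := by
  intro h
  obtain ⟨b, hb⟩ := σ.exists_ne_of_dim_pos hσ a
  have h' := σ.inner_grad a (σ.vertex a -ᵥ σ.vertex b)
  rw [h, inner_zero_left, comp_vsub, Pi.sub_apply, coord_vertex_self,
    σ.coord_vertex_of_ne hb.symm] at h'
  norm_num at h'

theorem height_eq_inv_norm_grad (σ : K.Simplex) (hσ : 0 < σ.dim) (a : σ.verts) :
    σ.height a = ‖σ.grad a‖⁻¹ := by
  have hg : 0 < ‖σ.grad a‖ := norm_pos_iff.2 (σ.grad_ne_zero hσ a)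
  have hmem (q : σ.Hull) : q ∈ (affineSpan ℝ (σ.vertex '' {a}ᶜ) : Set σ.Hull) ↔
      q.coord a = 0 := by
    rw [SetLike.mem_coe, mem_affineSpan_vertex_iff]
    simp
  have hself : (σ.grad a).comp a = ‖σ.grad a‖ ^ 2 := by
    rw [← inner_grad, real_inner_self_eq_norm_sq]
  -- The foot of the perpendicular: moving along the gradient changes `x_a` at rate `‖σ.grad a‖ ^
  -- 2`, so this multiple lowers it by exactly 1.
  have hfoot : -((‖σ.grad a‖ ^ 2)⁻¹ • σ.grad a) +ᵥ σ.vertex a ∈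
      (affineSpan ℝ (σ.vertex '' {a}ᶜ) : Set σ.Hull) := by
    rw [hmem, ← neg_smul, coord_vadd, Tangent.comp_smul, Pi.add_apply, Pi.smul_apply, hself,
      coord_vertex_self, smul_eq_mul]
    field_simp
    norm_num
  apply le_antisymm
  · refine (Metric.infDist_le_dist_of_mem hfoot).trans_eq ?_
    rw [dist_comm, dist_vadd_left, norm_neg, norm_smul, norm_inv, norm_pow, norm_norm]
    field_simp
  -- Cauchy–Schwarz: a displacement changing `x_a` by 1 has length at least `‖σ.grad a‖⁻¹`.
  · refine (Metric.le_infDist ⟨_, hfoot⟩).2 fun q hq => ?_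
    have h := real_inner_le_norm (σ.grad a) (σ.vertex a -ᵥ q)
    rw [inner_grad, comp_vsub, Pi.sub_apply, coord_vertex_self, (hmem q).1 hq, sub_zero] at h
    rw [dist_eq_norm_vsub σ.Tangent, inv_le_iff_one_le_mul₀' hg]
    exact h

/-! ### Finiteness of the volume. -/

theorem coord_le_one {σ : K.Simplex} {p : σ.Hull} (hp : p ∈ σ.carrier) (a : σ.verts) :
    p.coord a ≤ 1 :=
  (Finset.single_le_sum (fun b _ => hp b) (Finset.mem_univ a)).trans_eq p.sum_coord

theorem Tangent.inner_eq_edgeForm {σ : K.Simplex} (X Y : σ.Tangent) :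
    inner ℝ X Y = edgeForm (fun a b : σ.verts => sqLength K.length (a : V) (b : V))
      X.comp Y.comp := rfl

theorem norm_sq_le_of_abs_comp_le_one (σ : K.Simplex) (X : σ.Tangent)
    (hX : ∀ a, |X.comp a| ≤ 1) :
    ‖X‖ ^ 2 ≤ 1 / 2 * ∑ a : σ.verts, ∑ b : σ.verts, |sqLength K.length (a : V) (b : V)| := by
  rw [← real_inner_self_eq_norm_sq, Tangent.inner_eq_edgeForm, edgeForm, Finset.mul_sum,
    Finset.mul_sum]
  refine Finset.sum_le_sum fun a _ => ?_
  rw [Finset.mul_sum, Finset.mul_sum]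
  refine Finset.sum_le_sum fun b _ => ?_
  refine (le_abs_self _).trans ?_
  rw [abs_mul, abs_mul, abs_mul, abs_neg, abs_of_pos (by norm_num : (0 : ℝ) < 1 / 2)]
  gcongr
  calc |sqLength K.length (a : V) b| * |X.comp a| * |X.comp b|
      ≤ |sqLength K.length (a : V) b| * 1 * 1 := by gcongr <;> exact hX _
    _ = _ := by ring

/-- Seen from a vertex, points of `σ` are tangent vectors with components in `[-1, 1]`, a bounded
set. Finiteness makes constants integrable and keeps `vol` from taking the default value 0 of an
infinite measure. -/
theorem euclideanHausdorffMeasure_carrier_lt_top (σ : K.Simplex) :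
    Measure.euclideanHausdorffMeasure σ.dim σ.carrier < ⊤ := by
  obtain ⟨b⟩ : Nonempty σ.verts := ⟨⟨_, σ.verts_nonempty.choose_spec⟩⟩
  have hmp := EuclideanGeometry.measurePreserving_vaddConst (V := σ.Tangent) (σ.vertex b)
  rw [← finrank_tangent, ← hmp.measure_preimage σ.isClosed_carrier.nullMeasurableSet]
  refine Bornology.IsBounded.measure_lt_top (isBounded_iff_forall_norm_le.2
    ⟨√(1 / 2 * ∑ a : σ.verts, ∑ b : σ.verts, |sqLength K.length (a : V) (b : V)|),
      fun X hX => Real.le_sqrt_of_sq_le (σ.norm_sq_le_of_abs_comp_le_one X fun a => ?_)⟩)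
  have hX' : X +ᵥ σ.vertex b ∈ σ.carrier := hX
  have h0 := hX' a
  have h1 := coord_le_one hX' a
  rw [coord_vadd, Pi.add_apply] at h0 h1
  obtain rfl | hab := eq_or_ne a b
  · rw [coord_vertex_self] at h0 h1
    rw [abs_le]
    constructor <;> linarith
  · rw [σ.coord_vertex_of_ne hab] at h0 h1
    rw [abs_le]
    constructor <;> linarith

instance (σ : K.Simplex) : IsFiniteMeasure σ.volumeMeasure :=
  ⟨by
    rw [volumeMeasure, Measure.restrict_apply_univ]
    exact σ.euclideanHausdorffMeasure_carrier_lt_top⟩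

theorem vol_eq (σ : K.Simplex) :
    σ.vol = (Measure.euclideanHausdorffMeasure σ.dim σ.carrier).toReal := by
  rw [vol, volumeMeasure, Measure.real, Measure.restrict_apply_univ]

/-! ### Isometric inclusion of faces. -/

section Face

variable {ρ τ : K.Simplex}

/-- The inclusion of the vertices of a face. -/
def inclVerts (h : ρ.verts ⊆ τ.verts) (a : ρ.verts) : τ.verts := ⟨a, h a.2⟩

theorem inclVerts_injective (h : ρ.verts ⊆ τ.verts)
    : Function.Injective (inclVerts h) := fun _ _ hab =>
  Subtype.ext (congrArg (fun x : τ.verts => (x : V)) hab)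

/-- Extension by zero of functions on the vertices of a face. -/
def extendZero (f : ρ.verts → ℝ) (a : τ.verts) : ℝ :=
  if ha : (a : V) ∈ ρ.verts then f ⟨a, ha⟩ else 0

@[simp]
theorem extendZero_inclVerts (h : ρ.verts ⊆ τ.verts) (f : ρ.verts → ℝ) (a : ρ.verts) :
    extendZero f (inclVerts h a) = f a :=
  dif_pos a.2

theorem extendZero_of_notMem (f : ρ.verts → ℝ) {a : τ.verts} (ha : (a : V) ∉ ρ.verts) :
    extendZero f a = 0 :=
  dif_neg ha

theorem notMem_of_notMem_range_inclVerts (h : ρ.verts ⊆ τ.verts)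
    {a : τ.verts} (ha : a ∉ Set.range (inclVerts h)) :
    (a : V) ∉ ρ.verts :=
  fun ha' => ha ⟨⟨a, ha'⟩, rfl⟩

theorem sum_extendZero (h : ρ.verts ⊆ τ.verts)
    (f : ρ.verts → ℝ) : ∑ a : τ.verts, extendZero f a = ∑ a, f a :=
  (Fintype.sum_of_injective _ (inclVerts_injective h) _ _
    (fun _ ha => extendZero_of_notMem f (notMem_of_notMem_range_inclVerts h ha))
    (fun a => (extendZero_inclVerts h f a).symm)).symm

/-- The inclusion of the tangent space of a face. -/
def inclTangent (h : ρ.verts ⊆ τ.verts) (X : ρ.Tangent) : τ.Tangent :=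
  ⟨extendZero X.comp, (sum_extendZero h _).trans X.sum_comp⟩

theorem comp_inclTangent (h : ρ.verts ⊆ τ.verts)
    (X : ρ.Tangent) : (inclTangent h X).comp = extendZero X.comp := rfl

/-- Both forms use the same edge lengths, and extension by zero kills every term involving a vertex
outside the face. -/
theorem inner_inclTangent (h : ρ.verts ⊆ τ.verts) (X Y : ρ.Tangent) :
    inner ℝ (inclTangent h X) (inclTangent h Y) = inner ℝ X Y := by
  simp only [Tangent.inner_eq_edgeForm, edgeForm, comp_inclTangent]
  congr 1
  refine (Fintype.sum_of_injective _ (inclVerts_injective h) _ _ (fun a ha => ?_)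
    (fun a => Fintype.sum_of_injective _ (inclVerts_injective h) _ _ (fun b hb => ?_)
      (fun b => ?_))).symm
  · refine Finset.sum_eq_zero fun b _ => ?_
    rw [extendZero_of_notMem _ (notMem_of_notMem_range_inclVerts h ha), mul_zero, zero_mul]
  · change _ * extendZero Y.comp b = 0
    rw [extendZero_of_notMem _ (notMem_of_notMem_range_inclVerts h hb), mul_zero]
  · rw [extendZero_inclVerts, extendZero_inclVerts]
    rfl

theorem norm_inclTangent (h : ρ.verts ⊆ τ.verts) (X : ρ.Tangent) : ‖inclTangent h X‖ = ‖X‖ := by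
  rw [← sq_eq_sq₀ (norm_nonneg _) (norm_nonneg _), ← real_inner_self_eq_norm_sq,
    ← real_inner_self_eq_norm_sq, inner_inclTangent]

/-- The inclusion of the affine space spanned by a face. -/
def inclHull (h : ρ.verts ⊆ τ.verts)
    (p : ρ.Hull) : τ.Hull := ⟨extendZero p.coord, (sum_extendZero h _).trans p.sum_coord⟩

theorem coord_inclHull (h : ρ.verts ⊆ τ.verts)
    (p : ρ.Hull) : (inclHull h p).coord = extendZero p.coord := rfl

theorem isometry_inclHull (h : ρ.verts ⊆ τ.verts) : Isometry (inclHull h) := by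
  refine Isometry.of_dist_eq fun p q => ?_
  have : inclHull h p -ᵥ inclHull h q = inclTangent h (p -ᵥ q) := by
    refine Tangent.ext (funext fun a => ?_)
    rw [comp_vsub, comp_inclTangent, comp_vsub, Pi.sub_apply, coord_inclHull, coord_inclHull]
    unfold extendZero
    split_ifs <;> simp
  rw [dist_eq_norm_vsub τ.Tangent, dist_eq_norm_vsub ρ.Tangent, this, norm_inclTangent]

end Face

/-! ### Opposite facets and the volume of a cone. -/

/-- `ρ` is the face of `τ` opposite to the vertex `a`. -/
def IsOpposite (ρ τ : K.Simplex) (a : τ.verts) : Prop :=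
  ∀ v, v ∈ ρ.verts ↔ v ∈ τ.verts ∧ v ≠ a

theorem IsOpposite.subset {ρ τ : K.Simplex} {a : τ.verts} (h : IsOpposite ρ τ a) :
    ρ.verts ⊆ τ.verts := fun v hv => ((h v).1 hv).1

theorem IsOpposite.dim_add_one {ρ τ : K.Simplex} {a : τ.verts} (h : IsOpposite ρ τ a) :
    ρ.dim + 1 = τ.dim := by
  have hv : ρ.verts = τ.verts.erase a := by
    ext v
    rw [h v, Finset.mem_erase, and_comm]
  have h1 := ρ.verts_nonempty.card_pos
  rw [hv, Finset.card_erase_of_mem a.2] at h1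
  rw [dim, dim, hv, Finset.card_erase_of_mem a.2]
  omega

theorem IsOpposite.mem_iff {ρ τ : K.Simplex} {a : τ.verts} (h : IsOpposite ρ τ a) (b : τ.verts) :
    (b : V) ∈ ρ.verts ↔ b ≠ a := by
  rw [h b, Ne, Ne, Subtype.ext_iff]
  exact and_iff_right b.2

theorem IsOpposite.exists_inclHull_eq {ρ τ : K.Simplex} {a : τ.verts} (h : IsOpposite ρ τ a)
    (q : τ.Hull) (hq : q.coord a = 0) : ∃ p, inclHull h.subset p = q := by
  have hext : extendZero (fun b => q.coord (inclVerts h.subset b)) = q.coord := by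
    funext b
    by_cases hb : (b : V) ∈ ρ.verts
    · exact dif_pos hb
    · rw [extendZero_of_notMem _ hb]
      obtain rfl := not_not.1 (mt (h.mem_iff b).2 hb)
      exact hq.symm
  refine ⟨⟨fun b => q.coord (inclVerts h.subset b), ?_⟩, Hull.ext hext⟩
  rw [← sum_extendZero h.subset, hext, q.sum_coord]

theorem IsOpposite.exists_inclTangent_eq {ρ τ : K.Simplex} {a : τ.verts} (h : IsOpposite ρ τ a)
    (X : τ.Tangent) (hX : X.comp a = 0) : ∃ Y, inclTangent h.subset Y = X := by
  have hext : extendZero (fun b => X.comp (inclVerts h.subset b)) = X.comp := by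
    funext b
    by_cases hb : (b : V) ∈ ρ.verts
    · exact dif_pos hb
    · rw [extendZero_of_notMem _ hb]
      obtain rfl := not_not.1 (mt (h.mem_iff b).2 hb)
      exact hX.symm
  refine ⟨⟨fun b => X.comp (inclVerts h.subset b), ?_⟩, Tangent.ext hext⟩
  exact (sum_extendZero h.subset _).symm.trans ((congrArg (fun f => ∑ b, f b) hext).trans
    X.sum_comp)

theorem IsOpposite.inclHull_image_carrier {ρ τ : K.Simplex} {a : τ.verts}
    (h : IsOpposite ρ τ a) :
    inclHull h.subset '' ρ.carrier = τ.carrier ∩ {q | q.coord a = 0} := by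
  ext q
  constructor
  · rintro ⟨p, hp, rfl⟩
    refine ⟨fun b => ?_, extendZero_of_notMem _ fun ha => (h.mem_iff a).1 ha rfl⟩
    rw [coord_inclHull, extendZero]
    split_ifs
    exacts [hp _, le_rfl]
  · rintro ⟨hq, hq0⟩
    obtain ⟨p, rfl⟩ := h.exists_inclHull_eq q hq0
    exact ⟨p, fun b => (hq (inclVerts h.subset b)).trans_eq (extendZero_inclVerts _ _ b), rfl⟩

/-- The simplex is a cone with apex `a`: the homothety of ratio `1 - x` about the apex carries the
level 0 to the level `x`. It is invertible because `x < 1`. -/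
theorem carrier_inter_level (τ : K.Simplex) (a : τ.verts) {x : ℝ} (hx0 : 0 ≤ x) (hx1 : x < 1) :
    τ.carrier ∩ {q | q.coord a = x} =
      AffineMap.homothety (τ.vertex a) (1 - x) '' (τ.carrier ∩ {q | q.coord a = 0}) := by
  have hx : 0 < 1 - x := sub_pos.2 hx1
  have hc (q : τ.Hull) (c : ℝ) (b : τ.verts) :
      (AffineMap.homothety (τ.vertex a) c q).coord b =
        c * (q.coord b - (τ.vertex a).coord b) + (τ.vertex a).coord b := by
    simp [AffineMap.homothety_apply]
  ext q
  constructor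
  · rintro ⟨hq, rfl⟩
    refine ⟨AffineMap.homothety (τ.vertex a) (1 - q.coord a)⁻¹ q, ⟨fun b => ?_, ?_⟩, ?_⟩
    · rw [hc]
      obtain rfl | hb := eq_or_ne b a
      · rw [coord_vertex_self]
        field_simp
        norm_num
      · rw [τ.coord_vertex_of_ne hb, sub_zero, add_zero]
        exact mul_nonneg (inv_nonneg.2 hx.le) (hq b)
    · change (AffineMap.homothety (τ.vertex a) (1 - q.coord a)⁻¹ q).coord a = 0
      rw [hc, coord_vertex_self]
      field_simp
      ring
    · rw [← AffineMap.homothety_mul_apply, mul_inv_cancel₀ hx.ne', AffineMap.homothety_one]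
      rfl
  · rintro ⟨q, ⟨hq, hq0⟩, rfl⟩
    have hq0 : q.coord a = 0 := hq0
    refine ⟨fun b => ?_, ?_⟩
    · rw [hc]
      obtain rfl | hb := eq_or_ne b a
      · rw [coord_vertex_self, hq0]
        linarith
      · rw [τ.coord_vertex_of_ne hb, sub_zero, add_zero]
        exact mul_nonneg hx.le (hq b)
    · change (AffineMap.homothety (τ.vertex a) (1 - x) q).coord a = x
      rw [hc, coord_vertex_self, hq0]
      ring

theorem lintegral_one_sub_pow (m : ℕ) :
    ∫⁻ x in Set.Ioc (0 : ℝ) 1, ENNReal.ofReal ((1 - x) ^ m) = ENNReal.ofReal (1 / (m + 1)) := by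
  rw [← ofReal_integral_eq_lintegral_ofReal]
  · rw [← intervalIntegral.integral_of_le zero_le_one,
      intervalIntegral.integral_comp_sub_left (fun x : ℝ => x ^ m) 1]
    simp
  · exact ((by fun_prop : Continuous fun x : ℝ => (1 - x) ^ m).integrableOn_Icc).mono_set
      Set.Ioc_subset_Icc_self
  · filter_upwards [ae_restrict_mem measurableSet_Ioc] with x hx
    exact pow_nonneg (sub_nonneg.2 hx.2) m

/-- The volume of a simplex as a cone over a facet. -/
theorem IsOpposite.vol_eq {ρ τ : K.Simplex} {a : τ.verts} (h : IsOpposite ρ τ a) :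
    τ.vol = 1 / (τ.dim * ‖τ.grad a‖) * ρ.vol := by
  have hdim := h.dim_add_one
  have hpos : 0 < τ.dim := by omega
  have hg : 0 < ‖τ.grad a‖ := norm_pos_iff.2 (τ.grad_ne_zero hpos a)
  obtain ⟨b, hb⟩ := τ.exists_ne_of_dim_pos hpos a
  -- The height vector, normal to the facet and normalised so that `x_a` grows by 1 along it; the
  -- hyperplanes orthogonal to it, at parameter `x`, are then the levels of `x_a`.
  set v : τ.Tangent := (‖τ.grad a‖ ^ 2)⁻¹ • τ.grad a with hv
  have hv0 : v ≠ 0 := smul_ne_zero (by positivity) (norm_pos_iff.1 hg)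
  have hva : v.comp a = 1 := by
    rw [hv, Tangent.comp_smul, Pi.smul_apply, ← inner_grad, real_inner_self_eq_norm_sq,
      smul_eq_mul]
    field_simp
  have hvn : ‖v‖ = ‖τ.grad a‖⁻¹ := by
    rw [hv, norm_smul, norm_inv, norm_pow, norm_norm]
    field_simp
  have hslice (x : ℝ) :
      (AffineSubspace.mk' (x • v +ᵥ τ.vertex b) (Submodule.span ℝ {v})ᗮ : Set τ.Hull) =
        {q | q.coord a = x} := by
    ext q
    rw [SetLike.mem_coe, AffineSubspace.mem_mk', Submodule.mem_orthogonal_singleton_iff_inner_right,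
      hv, inner_smul_left, inner_grad, ← hv]
    simp [hva, τ.coord_vertex_of_ne hb.symm, hg.ne', sub_eq_zero]
  have hface : Measure.euclideanHausdorffMeasure ρ.dim (τ.carrier ∩ {q | q.coord a = 0}) =
      Measure.euclideanHausdorffMeasure ρ.dim ρ.carrier := by
    rw [← h.inclHull_image_carrier, (isometry_inclHull _).euclideanHausdorffMeasure_image]
  have hdim' : τ.dim - 1 = ρ.dim := by omega
  have hint : ∀ᵐ x : ℝ, Measure.euclideanHausdorffMeasure (τ.dim - 1)
        (τ.carrier ∩ AffineSubspace.mk' (x • v +ᵥ τ.vertex b) (Submodule.span ℝ {v})ᗮ) =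
      (Set.Ioc (0 : ℝ) 1).indicator (fun x => ENNReal.ofReal ((1 - x) ^ ρ.dim) *
        Measure.euclideanHausdorffMeasure ρ.dim ρ.carrier) x := by
    -- Two null values are discarded: at 0 the slice is the facet itself but 0 is outside `Ioc`, and
    -- at 1 the homothety degenerates.
    filter_upwards [Measure.ae_ne volume (0 : ℝ), Measure.ae_ne volume (1 : ℝ)] with x hx0 hx1
    rw [hslice, hdim']
    by_cases hx : x ∈ Set.Ioc (0 : ℝ) 1
    · have hx1 : x < 1 := lt_of_le_of_ne hx.2 hx1
      rw [Set.indicator_of_mem hx, τ.carrier_inter_level a hx.1.le hx1,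
        euclideanHausdorffMeasure_homothety_image _ _ (sub_pos.2 hx1).ne', hface,
        ENNReal.ofReal_pow (sub_pos.2 hx1).le, ← Real.enorm_of_nonneg (sub_pos.2 hx1).le]
      simp [ENNReal.smul_def, enorm]
    · rw [Set.indicator_of_notMem hx]
      convert measure_empty (μ := Measure.euclideanHausdorffMeasure ρ.dim) using 2
      rw [Set.eq_empty_iff_forall_notMem]
      rintro q ⟨hq, rfl⟩
      exact hx ⟨lt_of_le_of_ne (hq a) hx0.symm, coord_le_one hq a⟩
  -- Cavalieri's principle along `v`; the factor `‖v‖` is the height, and integrating `(1 - x) ^ (n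
  -- - 1)` gives `1 / n`.
  have hmain := EuclideanGeometry.euclideanHausdorffMeasure_eq_lintegral (τ.vertex b) hv0
    τ.isClosed_carrier.measurableSet
  rw [finrank_tangent, lintegral_congr_ae hint, lintegral_indicator measurableSet_Ioc,
    lintegral_mul_const _ (by fun_prop), lintegral_one_sub_pow] at hmain
  rw [τ.vol_eq, ρ.vol_eq, hmain, ENNReal.toReal_mul, ENNReal.toReal_mul,
    ENNReal.toReal_ofReal (by positivity), toReal_enorm, hvn, ← hdim]
  push_cast
  field_simp

/-! ### Gram determinants and gradients on a facet. -/

/-- The Gram determinant of the gradients of two barycentric coordinates. -/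
def gradGram (σ : K.Simplex) (a b : σ.verts) : ℝ :=
  ‖σ.grad a‖ ^ 2 * ‖σ.grad b‖ ^ 2 - inner ℝ (σ.grad a) (σ.grad b) ^ 2

theorem comp_grad_self (σ : K.Simplex) (a : σ.verts) : (σ.grad a).comp a = ‖σ.grad a‖ ^ 2 := by
  rw [← inner_grad, real_inner_self_eq_norm_sq]

theorem gradGram_comm (σ : K.Simplex) (a b : σ.verts) : σ.gradGram a b = σ.gradGram b a := by
  rw [gradGram, gradGram, real_inner_comm, mul_comm]

/-- The gradients of the barycentric coordinates of a facet are the orthogonal projections of the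
gradients of the barycentric coordinates of the simplex. -/
theorem IsOpposite.norm_grad_sq_mul {ρ τ : K.Simplex} {a : τ.verts} (h : IsOpposite ρ τ a)
    (b : ρ.verts) :
    ‖τ.grad a‖ ^ 2 * ‖ρ.grad b‖ ^ 2 = τ.gradGram a (inclVerts h.subset b) := by
  have hpos : 0 < τ.dim := by have := h.dim_add_one; omega
  have hg : 0 < ‖τ.grad a‖ := norm_pos_iff.2 (τ.grad_ne_zero hpos a)
  set c : τ.verts := inclVerts h.subset b with hc
  set C : ℝ := inner ℝ (τ.grad a) (τ.grad c) with hC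
  -- The component of `τ.grad c` orthogonal to `τ.grad a` has vanishing `a`-component, so it comes
  -- from the facet.
  obtain ⟨Y, hY⟩ := h.exists_inclTangent_eq (τ.grad c - (C / ‖τ.grad a‖ ^ 2) • τ.grad a) (by
    rw [Tangent.comp_sub, Tangent.comp_smul, Pi.sub_apply, Pi.smul_apply, comp_grad_self,
      ← inner_grad, ← hC, smul_eq_mul]
    field_simp
    ring)
  have hYg : Y = ρ.grad b := by
    refine ext_inner_right ℝ fun X => ?_
    have ha : (inclTangent h.subset X).comp a = 0 :=
      extendZero_of_notMem _ fun ha => (h.mem_iff a).1 ha rfl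
    rw [← inner_inclTangent h.subset, hY, inner_sub_left, inner_smul_left, inner_grad, inner_grad,
      ha, mul_zero, sub_zero, inner_grad, comp_inclTangent, hc, extendZero_inclVerts]
  rw [← hYg, ← norm_inclTangent h.subset, hY, norm_sub_sq_real, norm_smul, inner_smul_right,
    real_inner_comm, ← hC, gradGram, ← hC, mul_pow, Real.norm_eq_abs, sq_abs]
  field_simp
  ring

/-- The determinant is a product of two squared gradient norms, neither zero. If `ρ` were a point,
the two gradients on `τ` would be opposite and the determinant zero. -/
theorem IsOpposite.gradGram_pos {ρ τ : K.Simplex} {a : τ.verts} (h : IsOpposite ρ τ a)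
    (hρ : 0 < ρ.dim) (b : ρ.verts) : 0 < τ.gradGram a (inclVerts h.subset b) := by
  have hpos : 0 < τ.dim := by have := h.dim_add_one; omega
  have h1 := norm_pos_iff.2 (τ.grad_ne_zero hpos a)
  have h2 := norm_pos_iff.2 (ρ.grad_ne_zero hρ b)
  rw [← h.norm_grad_sq_mul]
  positivity

/-! ### The dihedral angle. -/

theorem mem_hingeDirection_iff (σ : K.Simplex) (hσ : 1 < σ.dim) (a b : σ.verts) (X : σ.Tangent) :
    X ∈ σ.hingeDirection a b ↔ X.comp a = 0 ∧ X.comp b = 0 := by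
  obtain ⟨c, hca, hcb⟩ := σ.exists_ne_ne_of_one_lt_dim hσ a b
  rw [hingeDirection, mem_direction_affineSpan_vertex_iff _ ⟨c, by simp [hca, hcb]⟩]
  simp only [Set.mem_compl_iff, not_not, Set.mem_insert_iff, Set.mem_singleton_iff,
    forall_eq_or_imp, forall_eq]

theorem coord_hingeCenter (σ : K.Simplex) (hσ : 1 < σ.dim) (a b : σ.verts) :
    (σ.hingeCenter a b).coord a = 0 ∧ (σ.hingeCenter a b).coord b = 0 := by
  obtain ⟨c, hca, hcb⟩ := σ.exists_ne_ne_of_one_lt_dim hσ a b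
  have hw := Finset.sum_centroidWeights_eq_one_of_nonempty ℝ ({a, b}ᶜ : Finset σ.verts)
    ⟨c, by simp [hca, hcb]⟩
  rw [hingeCenter, Finset.centroid_def, coord_affineCombination _ _ _ hw,
    coord_affineCombination _ _ _ hw]
  simp

theorem hingeDirection_comm (σ : K.Simplex) (a b : σ.verts) :
    σ.hingeDirection a b = σ.hingeDirection b a := by
  rw [hingeDirection, hingeDirection, Set.pair_comm]

theorem hingeCenter_comm (σ : K.Simplex) (a b : σ.verts) :
    σ.hingeCenter a b = σ.hingeCenter b a := by
  rw [hingeCenter, hingeCenter, Finset.pair_comm]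

/-- The direction from the face opposite to `a` and `b` towards `b`, orthogonal to that face, in
terms of gradients. -/
theorem starProjection_vertex_vsub_hingeCenter (σ : K.Simplex) (hσ : 1 < σ.dim) {a b : σ.verts}
    (hab : a ≠ b) (hD : 0 < σ.gradGram a b) :
    (σ.hingeDirection a b)ᗮ.starProjection (σ.vertex b -ᵥ σ.hingeCenter a b) =
      (σ.gradGram a b)⁻¹ •
        (‖σ.grad a‖ ^ 2 • σ.grad b - inner ℝ (σ.grad a) (σ.grad b) • σ.grad a) := by
  obtain ⟨ha, hb⟩ := σ.coord_hingeCenter hσ a b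
  have hD' := hD.ne'
  have hba : (σ.grad b).comp a = inner ℝ (σ.grad a) (σ.grad b) := (inner_grad _ _ _).symm
  have hab' : (σ.grad a).comp b = inner ℝ (σ.grad a) (σ.grad b) := by
    rw [← inner_grad, real_inner_comm]
  -- The candidate is a combination of gradients, hence orthogonal to the hinge. Its components are
  -- 0 at `a` and 1 at `b`, as for the projected vector, so the difference lies along the hinge.
  apply Submodule.eq_starProjection_of_mem_orthogonal
  · rw [Submodule.mem_orthogonal']
    intro X hX
    obtain ⟨hXa, hXb⟩ := (σ.mem_hingeDirection_iff hσ a b X).1 hX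
    rw [inner_smul_left, inner_sub_left, inner_smul_left, inner_smul_left,
      σ.inner_grad a X, σ.inner_grad b X, hXa, hXb]
    simp
  · rw [Submodule.orthogonal_orthogonal, mem_hingeDirection_iff _ hσ]
    simp only [Tangent.comp_sub, Tangent.comp_smul, comp_vsub, Pi.sub_apply, Pi.smul_apply,
      smul_eq_mul, ha, hb, coord_vertex_self, σ.coord_vertex_of_ne hab, comp_grad_self, hba, hab']
    constructor
    · ring
    · field_simp
      rw [gradGram]
      ring

/-- The directions `u, u'` are dual to the gradients, so their Gram matrix is the inverse of that of
the gradients: the off-diagonal entry `-C / D` yields the sign, and the determinant `1 / D` yields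
the sine. -/
theorem cot_dihedralAngle (σ : K.Simplex) (hσ : 1 < σ.dim) {a b : σ.verts} (hab : a ≠ b)
    (hD : 0 < σ.gradGram a b) :
    Real.cot (σ.dihedralAngle a b) =
      -(inner ℝ (σ.grad a) (σ.grad b) / √(σ.gradGram a b)) := by
  have hpos : 0 < σ.dim := by omega
  have hga := norm_pos_iff.2 (σ.grad_ne_zero hpos a)
  have hgb := norm_pos_iff.2 (σ.grad_ne_zero hpos b)
  have hu := σ.starProjection_vertex_vsub_hingeCenter hσ hab hD
  have hu' := σ.starProjection_vertex_vsub_hingeCenter hσ hab.symm (σ.gradGram_comm a b ▸ hD)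
  rw [σ.gradGram_comm b a, σ.hingeDirection_comm b a, σ.hingeCenter_comm b a,
    real_inner_comm] at hu'
  rw [dihedralAngle, hu, hu']
  set A := ‖σ.grad a‖ ^ 2 with hA
  set B := ‖σ.grad b‖ ^ 2 with hB
  set C : ℝ := inner ℝ (σ.grad a) (σ.grad b) with hC
  have hDdef : σ.gradGram a b = A * B - C ^ 2 := rfl
  set D := σ.gradGram a b with hDD
  have haa : inner ℝ (σ.grad a) (σ.grad a) = A := real_inner_self_eq_norm_sq _
  have hbb : inner ℝ (σ.grad b) (σ.grad b) = B := real_inner_self_eq_norm_sq _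
  have hba : inner ℝ (σ.grad b) (σ.grad a) = C := real_inner_comm _ _
  set u := D⁻¹ • (A • σ.grad b - C • σ.grad a) with hudef
  set u' := D⁻¹ • (B • σ.grad a - C • σ.grad b) with hudef'
  have huu : inner ℝ u u = A / D := by
    simp only [hudef, inner_smul_left, inner_smul_right, inner_sub_left, inner_sub_right, haa, hbb,
      hba, ← hC, conj_trivial]
    field_simp
    rw [hDdef]
    ring
  have huu' : inner ℝ u' u' = B / D := by
    simp only [hudef', inner_smul_left, inner_smul_right, inner_sub_left, inner_sub_right, haa,
      hbb, hba, ← hC, conj_trivial]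
    field_simp
    rw [hDdef]
    ring
  have hin : inner ℝ u u' = -C / D := by
    simp only [hudef, hudef', inner_smul_left, inner_smul_right, inner_sub_left, inner_sub_right,
      haa, hbb, hba, ← hC, conj_trivial]
    field_simp
    rw [hDdef]
    ring
  have hApos : 0 < A := by positivity
  have hBpos : 0 < B := by positivity
  have hn : 0 < ‖u‖ * ‖u'‖ := by
    have h1 : 0 < ‖u‖ ^ 2 := by rw [← real_inner_self_eq_norm_sq, huu]; positivity
    have h2 : 0 < ‖u'‖ ^ 2 := by rw [← real_inner_self_eq_norm_sq, huu']; positivity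
    rw [sq_pos_iff] at h1 h2
    positivity
  have hcos := InnerProductGeometry.cos_angle_mul_norm_mul_norm u u'
  have hsin := InnerProductGeometry.sin_angle_mul_norm_mul_norm u u'
  -- The determinant `1 / D` is written over a square so that its root becomes `√D / D`.
  have hs : A / D * (B / D) - -C / D * (-C / D) = D / D ^ 2 := by
    field_simp
    rw [hDdef]
  rw [huu, huu', hin, hs, Real.sqrt_div' _ (sq_nonneg D), Real.sqrt_sq hD.le] at hsin
  -- Expanding the fraction by `‖u‖ * ‖u'‖` turns cosine and sine into the inner product and the
  -- root of the Gram determinant.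
  rw [Real.cot_eq_cos_div_sin, ← mul_div_mul_right _ _ hn.ne', hcos, hsin, hin]
  have := Real.sqrt_pos.2 hD
  field_simp

/-! ### Assembling the formula. -/

theorem isOpposite_without_singleton (σ : K.Simplex) {i : V} (hi : i ∈ σ.verts)
    (h : ({i} : Finset V).card ≤ σ.dim) : IsOpposite (σ.without {i} h) σ ⟨i, hi⟩ := fun v => by
  simp [without]

theorem vol_mul_inner_grad_of_ne (σ : K.Simplex) (hσ : 1 < σ.dim) {i j : V} (hij : i ≠ j)
    (hi : i ∈ σ.verts) (hj : j ∈ σ.verts) (h : ({i, j} : Finset V).card ≤ σ.dim) :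
    σ.vol * inner ℝ (σ.grad ⟨i, hi⟩) (σ.grad ⟨j, hj⟩) =
      -(1 / ((σ.dim : ℝ) * ((σ.dim : ℝ) - 1))) * Real.cot (σ.dihedralAngle ⟨i, hi⟩ ⟨j, hj⟩)
        * (σ.without {i, j} h).vol := by
  set ρ := σ.without {i} ((Finset.card_singleton i).trans_le hσ.le) with hρdef
  have hρ : IsOpposite ρ σ ⟨i, hi⟩ := σ.isOpposite_without_singleton hi _
  have hjρ : j ∈ ρ.verts := (hρ j).2 ⟨hj, hij.symm⟩
  -- `IsOpposite` compares only vertices, so `σ ∖ {i, j}` serves directly as the facet of `ρ`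
  -- opposite to `j`.
  have hπ : IsOpposite (σ.without {i, j} h) ρ ⟨j, hjρ⟩ := fun v => by
    rw [hρ v]
    simp [without, and_assoc]
  have hdim := hρ.dim_add_one
  have hρpos : 0 < ρ.dim := by omega
  have hD : 0 < σ.gradGram ⟨i, hi⟩ ⟨j, hj⟩ := hρ.gradGram_pos hρpos ⟨j, hjρ⟩
  have hnorm : ‖σ.grad ⟨i, hi⟩‖ * ‖ρ.grad ⟨j, hjρ⟩‖ = √(σ.gradGram ⟨i, hi⟩ ⟨j, hj⟩) := by
    refine ((Real.sqrt_eq_iff_eq_sq hD.le (by positivity)).2 ?_).symm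
    rw [mul_pow, hρ.norm_grad_sq_mul]
    rfl
  rw [σ.cot_dihedralAngle hσ (fun h => hij (congrArg Subtype.val h)) hD, hρ.vol_eq, hπ.vol_eq,
    ← hnorm, ← hdim]
  have h1 := norm_pos_iff.2 (σ.grad_ne_zero (by omega) ⟨i, hi⟩)
  have h2 := norm_pos_iff.2 (ρ.grad_ne_zero hρpos ⟨j, hjρ⟩)
  have h3 : (0 : ℝ) < ρ.dim := by exact_mod_cast hρpos
  push_cast
  rw [add_sub_cancel_right]
  field_simp

theorem cotangentInner_zero_left (σ : K.Simplex) (φ : StrongDual ℝ σ.Tangent) :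
    σ.cotangentInner 0 φ = 0 := by
  simp [cotangentInner]

theorem cotangentInner_zero_right (σ : K.Simplex) (φ : StrongDual ℝ σ.Tangent) :
    σ.cotangentInner φ 0 = 0 := by
  simp [cotangentInner]

/-- Constancy irrespective of whether `i` belongs to `σ`, so that integrability needs no case
distinction. -/
theorem exists_differential_bary_eq (σ : K.Simplex) (i : V) :
    ∃ φ : StrongDual ℝ σ.Tangent, ∀ p, σ.differential (σ.bary i) p = φ := by
  by_cases hi : i ∈ σ.verts
  · exact ⟨_, σ.differential_bary ⟨i, hi⟩⟩
  · exact ⟨_, σ.differential_bary_of_notMem hi⟩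

theorem integral_const_volumeMeasure (σ : K.Simplex) (c : ℝ) :
    ∫ _, c ∂σ.volumeMeasure = σ.vol * c := by
  rw [integral_const, smul_eq_mul, vol]

end Simplex

end EuclideanSimplicialComplex

end

theorem mainTheorem11 {V : Type*} [DecidableEq V] (K : EuclideanSimplicialComplex V)
    (σ : K.Simplex) (hσ : 1 < σ.dim) (i j : V) :
    (Integrable (fun p => σ.cotangentInner (σ.differential (σ.bary i) p)
        (σ.differential (σ.bary j) p)) σ.volumeMeasure ∧
      (i ≠ j →
        (∀ (hi : i ∈ σ.verts) (hj : j ∈ σ.verts),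
          ∫ p, σ.cotangentInner (σ.differential (σ.bary i) p) (σ.differential (σ.bary j) p)
              ∂σ.volumeMeasure
            = -(1 / ((σ.dim : ℝ) * ((σ.dim : ℝ) - 1))) * Real.cot (σ.dihedralAngle ⟨i, hi⟩ ⟨j, hj⟩)
              * (σ.without {i, j} (Finset.card_le_two.trans hσ)).vol) ∧
        (¬ (i ∈ σ.verts ∧ j ∈ σ.verts) →
          ∫ p, σ.cotangentInner (σ.differential (σ.bary i) p) (σ.differential (σ.bary j) p)
              ∂σ.volumeMeasure = 0))) ∧
    (Integrable (fun p => ‖σ.differential (σ.bary i) p‖ ^ 2) σ.volumeMeasure ∧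
      (∀ hi : i ∈ σ.verts,
        ∫ p, ‖σ.differential (σ.bary i) p‖ ^ 2 ∂σ.volumeMeasure
          = 1 / ((σ.dim : ℝ) * σ.height ⟨i, hi⟩)
            * (σ.without {i} ((Finset.card_singleton i).trans_le hσ.le)).vol) ∧
      (i ∉ σ.verts →
        ∫ p, ‖σ.differential (σ.bary i) p‖ ^ 2 ∂σ.volumeMeasure = 0)) := by
  obtain ⟨φ, hφ⟩ := σ.exists_differential_bary_eq i
  obtain ⟨ψ, hψ⟩ := σ.exists_differential_bary_eq j
  have hpos : 0 < σ.dim := by omega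
  refine ⟨⟨?_, fun hij => ⟨fun hi hj => ?_, fun h => ?_⟩⟩, ?_, fun hi => ?_, fun hi => ?_⟩
  · simp only [hφ, hψ]
    exact integrable_const _
  · simp only [σ.differential_bary ⟨i, hi⟩, σ.differential_bary ⟨j, hj⟩,
      σ.cotangentInner_coordCLM, σ.integral_const_volumeMeasure]
    exact σ.vol_mul_inner_grad_of_ne hσ hij hi hj _
  · obtain hi | hj := not_and_or.1 h
    · simp [σ.differential_bary_of_notMem hi, σ.cotangentInner_zero_left]
    · simp [σ.differential_bary_of_notMem hj, σ.cotangentInner_zero_right]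
  · simp only [hφ]
    exact integrable_const _
  · have hρ := σ.isOpposite_without_singleton hi ((Finset.card_singleton i).trans_le hσ.le)
    have hg := norm_pos_iff.2 (σ.grad_ne_zero hpos ⟨i, hi⟩)
    simp only [σ.differential_bary ⟨i, hi⟩, σ.norm_coordCLM, σ.integral_const_volumeMeasure,
      hρ.vol_eq, σ.height_eq_inv_norm_grad hpos]
    field_simp
  · simp [σ.differential_bary_of_notMem hi]
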